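/- Let $n\geq 1$ and let $\Omega\subset\mathbb{R}^n$ be a bounded Lipschitz domain, i.e. a nonempty bounded open connected set which near each boundary point is, in suitable orthonormal coordinates, the strict subgraph of a Lipschitz function. Write $|A|$ for Lebesgue measure, $\omega_n$ for the measure of the unit ball of $\mathbb{R}^n$, $\langle f\rangle_\Omega:=\frac1{|\Omega|}\int_\Omega f$, and let $C^\infty(\overline\Omega)$ be the set of real functions that are smooth in $\Omega$ and all of whose derivatives (including the function itself) extend continuously to $\overline\Omega$. (i) For every $1\leq p<\infty$ there is a constant $\tilde C>0$ depending only on $\Omega$ and $p$ such that $$\int_\Omega |f(x)-\langle f\rangle_\Omega|^p\,dx\;\leq\;\tilde C\int_\Omega|\nabla f(z)|^p\,dz\qquad\text{for all } f\in C^\infty(\overline\Omega).$$ (ii) The constant can be taken explicitly as follows. There are an integer $N\geq 2$, a radius $R>0$ and bounded domains (nonempty open connected sets) $D_1,\dots,D_N$ with $\Omega=\bigcup_{i=1}^N D_i$, such that each $D_i$ contains an open ball $S_i$ of radius $R$ with respect to which it is starshaped (that is, $[x,y]\subset D_i$ for all $x\in S_i$, $y\in D_i$), and such that $D_{i+1}\cap\bigcup_{j=1}^{i}D_j\neq\emptyset$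 for $1\leq i\leq N-1$. For every such decomposition of $\Omega$ and every $1\leq p<\infty$, the inequality in (i) holds for all $f\in C^\infty(\overline\Omega)$ with the positive constant $$\tilde C=C\,(n+1)\,\omega_n^{1-\frac1n}\,|\Omega|^{\frac1n},\qquad C=\frac{\lambda}{\omega_nR^n}\left(1+2^{p+1}\frac{\kappa}{\lambda}\right)^N\frac{(\max\{\operatorname{diam}(\Omega),1\})^{n+p-1}}{n|\Omega|},$$ where $\kappa=(n+1)\,\omega_n\operatorname{diam}(\Omega)^n$ and $\lambda=\min_{1\leq i\leq N-1}\bigl|D_{i+1}\cap\bigcup_{j=1}^iD_j\bigr|$. -/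

import Mathlib

open Set MeasureTheory
open scoped ContDiff

noncomputable section

/-- `Ω` is a bounded Lipschitz domain: a bounded, open, connected (and nonempty) set such that near
each boundary point `x`, after choosing a unit vector `ν` (the direction of the last coordinate
axis), `Ω` is the strict subgraph of a Lipschitz function `γ` of the component `y - ⟪ν, y⟫ ν` of
`y` orthogonal to `ν`. -/
structure IsBoundedLipschitzDomain {n : ℕ} (Ω : Set (EuclideanSpace ℝ (Fin n))) : Prop where
  isOpen : IsOpen Ω
  isConnected : IsConnected Ω
  isBounded : Bornology.IsBounded Ω
  lipschitz_boundary : ∀ x ∈ frontier Ω,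
    ∃ (r : ℝ) (ν : EuclideanSpace ℝ (Fin n)) (K : NNReal) (γ : EuclideanSpace ℝ (Fin n) → ℝ),
      0 < r ∧ ‖ν‖ = 1 ∧ LipschitzWith K γ ∧
      Ω ∩ Metric.ball x r =
        {y ∈ Metric.ball x r | inner ℝ ν y < γ (y - (inner ℝ ν y) • ν)}

/-- `f ∈ C^∞(closure Ω)`: `f` is smooth in the open set `Ω` and all its derivatives (including the
one of order `0`) extend continuously to the closure of `Ω`. Only values of `f` in `Ω` matter. -/
def SmoothUpToBoundary {n : ℕ} (Ω : Set (EuclideanSpace ℝ (Fin n)))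
    (f : EuclideanSpace ℝ (Fin n) → ℝ) : Prop :=
  ContDiffOn ℝ ∞ f Ω ∧
    ∀ k : ℕ, ∃ g : EuclideanSpace ℝ (Fin n) → (EuclideanSpace ℝ (Fin n)) [×k]→L[ℝ] ℝ,
      ContinuousOn g (closure Ω) ∧ EqOn g (iteratedFDeriv ℝ k f) Ω

/-- `D` is starshaped with respect to its subset `S`: for all `x ∈ S` and `y ∈ D`, the segment
`[x, y]` lies in `D`. -/
def StarshapedWrt {n : ℕ} (D S : Set (EuclideanSpace ℝ (Fin n))) : Prop :=
  S.Nonempty ∧ S ⊆ D ∧ ∀ x ∈ S, ∀ y ∈ D, segment ℝ x y ⊆ D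

/-- `Ω` is the union of the finite chain of bounded domains `D 0, …, D (N - 1)`; each one is
starshaped with respect to an open ball of radius `R` contained in it, and each one after the first
meets the union of its predecessors. -/
structure IsStarshapedChain {n : ℕ} (Ω : Set (EuclideanSpace ℝ (Fin n))) (N : ℕ) (R : ℝ)
    (D : Fin N → Set (EuclideanSpace ℝ (Fin n))) : Prop where
  radius_pos : 0 < R
  isOpen : ∀ i, IsOpen (D i)
  isConnected : ∀ i, IsConnected (D i)
  isBounded : ∀ i, Bornology.IsBounded (D i)
  starshaped : ∀ i, ∃ c, StarshapedWrt (D i) (Metric.ball c R)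
  chain : ∀ i : Fin N, 0 < i.val → (D i ∩ ⋃ j < i, D j).Nonempty
  iUnion_eq : ⋃ i, D i = Ω

/-- The measure `ω_n` of the unit ball of `ℝⁿ`. -/
def unitBallVolume (n : ℕ) : ℝ :=
  volume.real (Metric.ball (0 : EuclideanSpace ℝ (Fin n)) 1)

/-- `κ(Ω) = (n + 1) ω_n diam(Ω)^n`. -/
def kappa {n : ℕ} (Ω : Set (EuclideanSpace ℝ (Fin n))) : ℝ :=
  (n + 1) * unitBallVolume n * Metric.diam Ω ^ n

/-- `λ`: the least of the measures of the overlaps `D i ∩ ⋃ j < i, D j`, over all indices `i` but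
the first one (meaningful for chains of length at least `2`). -/
def minOverlap {n N : ℕ} (D : Fin N → Set (EuclideanSpace ℝ (Fin n))) : ℝ :=
  ⨅ i : {i : Fin N // 0 < i.val}, volume.real (D i.1 ∩ ⋃ j < i.1, D j)

/-- The constant
`C = λ / (ω_n R^n) * (1 + 2^(p+1) κ(Ω) / λ)^N * max (diam Ω) 1 ^ (n+p-1) / (n |Ω|)`. -/
def chainConst {n N : ℕ} (Ω : Set (EuclideanSpace ℝ (Fin n))) (R : ℝ)
    (D : Fin N → Set (EuclideanSpace ℝ (Fin n))) (p : ℝ) : ℝ :=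
  minOverlap D / (unitBallVolume n * R ^ n)
    * (1 + (2 : ℝ) ^ (p + 1) * (kappa Ω / minOverlap D)) ^ N
    * (max (Metric.diam Ω) 1 ^ ((n : ℝ) + p - 1) / (n * volume.real Ω))

/-- The constant `C (n + 1) ω_n^(1 - 1/n) |Ω|^(1/n)`. -/
def poincareConst {n N : ℕ} (Ω : Set (EuclideanSpace ℝ (Fin n))) (R : ℝ)
    (D : Fin N → Set (EuclideanSpace ℝ (Fin n))) (p : ℝ) : ℝ :=
  chainConst Ω R D p * ((n : ℝ) + 1) * unitBallVolume n ^ (1 - 1 / (n : ℝ))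
    * volume.real Ω ^ (1 / (n : ℝ))

/-- The inequality `∫_Ω |f - ⟨f⟩_Ω|^p ≤ C ∫_Ω |∇f|^p`, with `⟨f⟩_Ω` the mean value of `f`. -/
def PoincareWirtinger {n : ℕ} (Ω : Set (EuclideanSpace ℝ (Fin n))) (p C : ℝ)
    (f : EuclideanSpace ℝ (Fin n) → ℝ) : Prop :=
  ∫ x in Ω, |f x - ⨍ y in Ω, f y| ^ p ≤ C * ∫ z in Ω, ‖gradient f z‖ ^ p

end

/-! The mean deviation of `f` is dominated by the double integral `oscInt` of `|f x - f y| ^ p` over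
`Ω × Ω`, divided by `|Ω|`, so it is enough to bound `oscInt` by the integral of `|∇f| ^ p`. If `x`
lies in the ball `S` of a starshaped piece `D` and `y` in `D`, the segment between them stays in
`Ω`; integrating the gradient along it and changing variables leads to a Riesz potential of `|∇f| ^
p` (`lintegral_lintegral_segment_le`, `oscInt_starshaped_le`). Two points of `D` are then compared
through a third point averaged over `S`, and points of different pieces through a third point in an
overlap. Both comparisons are `measure_mul_oscInt_le`; iterating the second along the chain gives
the power `N` (`oscInt_chain_le`). A decomposition exists because, near each point of the closure,
`Ω` is visible from a whole ball (`exists_visible_ball`). Compactness makes the cover finite, and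
connectedness orders it into a chain (`exists_chain_listing`). -/

/-! ### Decomposition of a Lipschitz domain into a chain of starshaped pieces. -/

section Decomposition

variable {n : ℕ}

local notation "E" => EuclideanSpace ℝ (Fin n)

/-- The union of all segments from points of `S` to points of `A`. -/
def segmentHull (S A : Set E) : Set E := {w | ∃ z ∈ S, ∃ y ∈ A, w ∈ segment ℝ z y}

theorem subset_segmentHull_left {S A : Set E} (hA : A.Nonempty) : S ⊆ segmentHull S A :=
  fun z hz => ⟨z, hz, hA.some, hA.some_mem, left_mem_segment ℝ _ _⟩

theorem subset_segmentHull_right {S A : Set E} (hS : S.Nonempty) : A ⊆ segmentHull S A :=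
  fun y hy => ⟨hS.some, hS.some_mem, y, hy, right_mem_segment ℝ _ _⟩

/-- The hull is the union over `y ∈ A` of the joins of `S` with `y`; each join is convex and
contains `S`. -/
theorem starshapedWrt_segmentHull {S A : Set E} (hS : S.Nonempty) (hc : Convex ℝ S)
    (hA : A.Nonempty) : StarshapedWrt (segmentHull S A) S := by
  refine ⟨hS, subset_segmentHull_left hA, ?_⟩
  rintro z₁ hz₁ w ⟨z, hz, y, hy, hw⟩ u hu
  have hconv : u ∈ convexJoin ℝ S {y} := by
    have h1 : Convex ℝ (convexJoin ℝ S {y}) := hc.convexJoin (convex_singleton y)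
    refine h1.segment_subset ?_ ?_ hu
    · exact subset_convexJoin_left (singleton_nonempty y) hz₁
    · exact mem_convexJoin.2 ⟨z, hz, y, rfl, hw⟩
  obtain ⟨z₂, hz₂, y₂, hy₂, h⟩ := mem_convexJoin.1 hconv
  rw [mem_singleton_iff] at hy₂
  subst hy₂
  exact ⟨z₂, hz₂, y₂, hy, h⟩

/-- A point `a • z + b • y` with `a > 0` has as neighbourhood the image of `S` under the homothety
with `y` fixed; if `a = 0` the point is `y`, and `A` is a neighbourhood. -/
theorem isOpen_segmentHull {S A : Set E} (hS : IsOpen S) (hA : IsOpen A) :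
    IsOpen (segmentHull S A) := by
  rw [isOpen_iff_mem_nhds]
  rintro w ⟨z, hz, y, hy, a, b, ha, hb, hab, rfl⟩
  rcases eq_or_lt_of_le ha with h0 | h0
  · subst h0
    have hb1 : b = 1 := by linarith
    subst hb1
    rw [zero_smul, one_smul, zero_add]
    exact Filter.mem_of_superset (hA.mem_nhds hy) (subset_segmentHull_right ⟨z, hz⟩)
  · have hcont : Continuous fun w : E => a⁻¹ • (w - b • y) := by fun_prop
    have hpre : IsOpen ((fun w : E => a⁻¹ • (w - b • y)) ⁻¹' S) := hS.preimage hcont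
    refine Filter.mem_of_superset (hpre.mem_nhds ?_) ?_
    · simp only [mem_preimage, add_sub_cancel_right, smul_smul, inv_mul_cancel₀ h0.ne', one_smul]
      exact hz
    · intro v hv
      refine ⟨_, hv, y, hy, a, b, ha, hb, hab, ?_⟩
      rw [smul_smul, mul_inv_cancel₀ h0.ne', one_smul, sub_add_cancel]

theorem StarshapedWrt.isConnected {D S : Set E} (h : StarshapedWrt D S) : IsConnected D := by
  obtain ⟨⟨c, hc⟩, hSD, hst⟩ := h
  refine ⟨⟨c, hSD hc⟩, ?_⟩
  have : StarConvex ℝ c D := starConvex_iff_segment_subset.2 fun y hy => hst c hc y hy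
  exact (this.isPathConnected (hSD hc)).isConnected.isPreconnected

theorem StarshapedWrt.mono_ball {D : Set E} {c : E} {r s : ℝ} (hr : 0 < r) (hrs : r ≤ s)
    (h : StarshapedWrt D (Metric.ball c s)) : StarshapedWrt D (Metric.ball c r) :=
  ⟨⟨c, Metric.mem_ball_self hr⟩, (Metric.ball_subset_ball hrs).trans h.2.1,
    fun x hx => h.2.2 x (Metric.ball_subset_ball hrs hx)⟩

/-- Near a boundary point, a Lipschitz domain is visible from a whole ball inside it. -/
theorem exists_visible_ball_of_mem_frontier {Ω : Set E} (hΩ : IsBoundedLipschitzDomain Ω) {x : E}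
    (hx : x ∈ frontier Ω) : ∃ (c : E) (s : ℝ), 0 < s ∧
      ∀ z ∈ Metric.ball c s, ∀ y ∈ Metric.ball x s ∩ Ω, segment ℝ z y ⊆ Ω := by
  obtain ⟨r, ν, K, γ, hr, hν, hγ, hgraph⟩ := hΩ.lipschitz_boundary x hx
  have hK : (0 : ℝ) ≤ K := K.2
  -- The ball is centred at depth `h = r / 2` below `x`. Since `s + h ≤ r`, it stays in the graph
  -- chart; since `2 * s * (1 + K) ≤ h`, every direction from it to a point near `x` is steep enough
  -- for the Lipschitz cone condition.
  set s : ℝ := r / (8 * (1 + K)) with hs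
  have hspos : 0 < s := by positivity
  have hsr : 8 * (s * (1 + K)) = r := by rw [hs]; field_simp
  have hsK : 0 ≤ s * K := by positivity
  set h : ℝ := 4 * s * (1 + K) with hh
  refine ⟨x - h • ν, s, hspos, ?_⟩
  rintro z hz y ⟨hy, hyΩ⟩ w ⟨a, b, ha, hb, hab, rfl⟩
  have hballsub : Metric.ball x s ⊆ Metric.ball x r := Metric.ball_subset_ball (by nlinarith)
  have hyr := hballsub hy
  have hzr : z ∈ Metric.ball x r := by
    rw [Metric.mem_ball, dist_eq_norm] at hz ⊢
    calc ‖z - x‖ = ‖(z - (x - h • ν)) - h • ν‖ := by congr 1; abel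
      _ ≤ ‖z - (x - h • ν)‖ + ‖h • ν‖ := norm_sub_le _ _
      _ < s + h := by
        have : ‖h • ν‖ = h := by rw [norm_smul, hν, Real.norm_of_nonneg (by positivity), mul_one]
        linarith
      _ ≤ r := by nlinarith
  have hwr : a • z + b • y ∈ Metric.ball x r := (convex_ball x r) hzr hyr ha hb hab
  have hyg : inner ℝ ν y < γ (y - (inner ℝ ν y) • ν) := by
    have : y ∈ Ω ∩ Metric.ball x r := ⟨hyΩ, hyr⟩
    rw [hgraph] at this
    exact this.2
  suffices hsuff : a • z + b • y ∈ Ω ∩ Metric.ball x r from hsuff.1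
  rw [hgraph]
  refine ⟨hwr, ?_⟩
  -- the vector `v = y - z` is `h • ν` up to an error `e` of norm less than `2 s`
  set e : E := y - z - h • ν with he
  have hen : ‖e‖ ≤ 2 * s := by
    rw [Metric.mem_ball, dist_eq_norm] at hz hy
    calc ‖e‖ = ‖(y - x) - (z - (x - h • ν))‖ := by rw [he]; congr 1; abel
      _ ≤ ‖y - x‖ + ‖z - (x - h • ν)‖ := norm_sub_le _ _
      _ ≤ 2 * s := by linarith
  have hνν : inner ℝ ν ν = (1 : ℝ) := by rw [real_inner_self_eq_norm_sq, hν]; norm_num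
  have hw : a • z + b • y = y - a • (e + h • ν) := by
    have hb' : b = 1 - a := by linarith
    rw [he, hb']
    module
  have hie : |inner ℝ ν e| ≤ ‖e‖ := by
    simpa [hν] using abs_real_inner_le_norm ν e
  have hperp : ‖e - (inner ℝ ν e : ℝ) • ν‖ ≤ ‖e‖ := by
    have h1 : ‖e - (inner ℝ ν e : ℝ) • ν‖ ^ 2 ≤ ‖e‖ ^ 2 := by
      rw [norm_sub_sq_real, inner_smul_right, norm_smul, hν, real_inner_comm ν e, mul_one,
        Real.norm_eq_abs, sq_abs]
      nlinarith [sq_nonneg (inner ℝ ν e : ℝ)]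
    exact abs_le_of_sq_le_sq' h1 (norm_nonneg _) |>.2
  have hinner : (inner ℝ ν (a • z + b • y) : ℝ) = inner ℝ ν y - a * (inner ℝ ν e + h) := by
    rw [hw, inner_sub_right, inner_smul_right, inner_add_right, inner_smul_right, hνν, mul_one]
  have hdiff : (y - (inner ℝ ν y : ℝ) • ν)
      - ((a • z + b • y) - (inner ℝ ν (a • z + b • y) : ℝ) • ν)
        = a • (e - (inner ℝ ν e : ℝ) • ν) := by
    rw [hinner, hw]
    module
  have hlip := hγ.dist_le_mul (y - (inner ℝ ν y : ℝ) • ν)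
    ((a • z + b • y) - (inner ℝ ν (a • z + b • y) : ℝ) • ν)
  rw [dist_eq_norm, dist_eq_norm, hdiff, norm_smul, Real.norm_of_nonneg ha] at hlip
  -- Moving back from `y` by the fraction `a` lowers the height by at least `a * (h - 2 * s)`, while
  -- the graph drops by at most `K * a * 2 * s`; `h4` compares the two.
  have h1 := (abs_le.1 hlip).2
  have h2 : (K : ℝ) * (a * ‖e - (inner ℝ ν e : ℝ) • ν‖) ≤ K * (a * (2 * s)) := by
    gcongr
    exact hperp.trans hen
  have h3 : a * (-(2 * s) + h) ≤ a * (inner ℝ ν e + h) := by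
    gcongr
    exact neg_le_of_neg_le (by linarith [(abs_le.1 (hie.trans hen)).1])
  have h4 : (K : ℝ) * (a * (2 * s)) ≤ a * (-(2 * s) + h) := by
    have : (K : ℝ) * (2 * s) ≤ -(2 * s) + h := by rw [hh]; nlinarith
    calc (K : ℝ) * (a * (2 * s)) = a * (K * (2 * s)) := by ring
      _ ≤ _ := mul_le_mul_of_nonneg_left this ha
  rw [hinner] at h1 ⊢
  linarith

theorem exists_visible_ball {Ω : Set E} (hΩ : IsBoundedLipschitzDomain Ω) {x : E}
    (hx : x ∈ closure Ω) : ∃ (c : E) (s : ℝ), 0 < s ∧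
      ∀ z ∈ Metric.ball c s, ∀ y ∈ Metric.ball x s ∩ Ω, segment ℝ z y ⊆ Ω := by
  by_cases hxΩ : x ∈ Ω
  · obtain ⟨s, hs, hsub⟩ := Metric.isOpen_iff.1 hΩ.isOpen x hxΩ
    exact ⟨x, s, hs, fun z hz y hy => ((convex_ball x s).segment_subset hz hy.1).trans hsub⟩
  · refine exists_visible_ball_of_mem_frontier hΩ ?_
    rw [hΩ.isOpen.frontier_eq]
    exact ⟨hx, hxΩ⟩

/-- A bounded Lipschitz domain is a finite union of open subsets that are starshaped with respect
to balls of the same radius. -/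
theorem exists_finite_starshaped_cover {Ω : Set E} (hΩ : IsBoundedLipschitzDomain Ω) :
    ∃ (ι : Type) (_ : Finite ι) (D : ι → Set E) (R : ℝ), 0 < R ∧ (∀ i, IsOpen (D i)) ∧
      (∀ i, ∃ c, StarshapedWrt (D i) (Metric.ball c R)) ∧ ⋃ i, D i = Ω := by
  have hcomp : IsCompact (closure Ω) := hΩ.isBounded.isCompact_closure
  choose! c s hs hvis using fun x (hx : x ∈ closure Ω) => exists_visible_ball hΩ hx
  obtain ⟨t, htsub, htcov⟩ := hcomp.elim_nhds_subcover (fun x => Metric.ball x (s x))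
    fun x hx => Metric.ball_mem_nhds x (hs x hx)
  have htne : t.Nonempty := by
    obtain ⟨y, hy⟩ := hΩ.isConnected.nonempty
    obtain ⟨x, hx, -⟩ := mem_iUnion₂.1 (htcov (subset_closure hy))
    exact ⟨x, hx⟩
  obtain ⟨x₀, hx₀, hmin⟩ := t.exists_min_image s htne
  have hball : ∀ x ∈ t, (Metric.ball x (s x) ∩ Ω).Nonempty := fun x hx => by
    obtain ⟨y, hyΩ, hy⟩ := Metric.mem_closure_iff.1 (htsub x hx) (s x) (hs x (htsub x hx))
    exact ⟨y, by rwa [Metric.mem_ball, dist_comm], hyΩ⟩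
  let e := t.equivFin
  have hmem : ∀ i, ((e.symm i : t) : E) ∈ t := fun i => (e.symm i).2
  refine ⟨Fin t.card, inferInstance, fun i => segmentHull
    (Metric.ball (c (e.symm i)) (s (e.symm i)))
    (Metric.ball (e.symm i : E) (s (e.symm i)) ∩ Ω), s x₀, hs x₀ (htsub x₀ hx₀), ?_, ?_, ?_⟩
  · exact fun i => isOpen_segmentHull Metric.isOpen_ball (Metric.isOpen_ball.inter hΩ.isOpen)
  · refine fun i => ⟨c (e.symm i), ?_⟩
    refine StarshapedWrt.mono_ball (hs x₀ (htsub x₀ hx₀)) (hmin _ (hmem i)) ?_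
    exact starshapedWrt_segmentHull ⟨_, Metric.mem_ball_self (hs _ (htsub _ (hmem i)))⟩
      (convex_ball _ _) (hball _ (hmem i))
  · refine Subset.antisymm (iUnion_subset fun i => ?_) fun y hy => ?_
    · rintro w ⟨z, hz, y, hy, hw⟩
      exact hvis _ (htsub _ (hmem i)) z hz y hy hw
    · obtain ⟨x, hx, hyx⟩ := mem_iUnion₂.1 (htcov (subset_closure hy))
      refine mem_iUnion.2 ⟨e ⟨x, hx⟩, ?_⟩
      rw [Equiv.symm_apply_apply]
      exact subset_segmentHull_right ⟨_, Metric.mem_ball_self (hs _ (htsub _ hx))⟩ ⟨hyx, hy⟩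

/-- A finite family of open sets that covers a connected set can be listed, with repetitions, so
that each set meets the union of its predecessors. -/
theorem exists_chain_listing {X ι : Type*} [TopologicalSpace X] [Finite ι] {Ω : Set X}
    (hΩ : IsConnected Ω) (D : ι → Set X) (hD : ∀ i, IsOpen (D i)) (hne : ∀ i, (D i).Nonempty)
    (hU : ⋃ i, D i = Ω) : ∃ (N : ℕ) (e : ℕ → ι), 0 < N ∧
      (∀ i, 0 < i → i < N → (D (e i) ∩ ⋃ j < i, D (e j)).Nonempty) ∧
      ⋃ j < N, D (e j) = Ω := by
  classical
  have := Fintype.ofFinite ι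
  obtain ⟨x₀, hx₀⟩ := hΩ.nonempty
  rw [← hU] at hx₀
  obtain ⟨i₀, -⟩ := mem_iUnion.1 hx₀
  -- Induction on the number `k` of distinct sets listed: a list that does not yet cover `Ω` can be
  -- prolonged by a new set. With `k` above the cardinality of `ι`, only covering remains possible.
  have key : ∀ k : ℕ, ∃ (N : ℕ) (e : ℕ → ι), 0 < N ∧
      (∀ i, 0 < i → i < N → (D (e i) ∩ ⋃ j < i, D (e j)).Nonempty) ∧
      (⋃ j < N, D (e j) = Ω ∨ k ≤ ((Finset.range N).image e).card) := by
    intro k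
    induction k with
    | zero =>
      exact ⟨1, fun _ => i₀, one_pos, fun i h0 h1 => by omega, Or.inr (Nat.zero_le _)⟩
    | succ k ih =>
      obtain ⟨N, e, hN, hch, h | h⟩ := ih
      · exact ⟨N, e, hN, hch, Or.inl h⟩
      by_cases hfull : ⋃ j < N, D (e j) = Ω
      · exact ⟨N, e, hN, hch, Or.inl hfull⟩
      set A : Set X := ⋃ j < N, D (e j) with hA
      set B : Set X := ⋃ i ∈ {i | i ∉ (Finset.range N).image e}, D i with hB
      have hmemA : ∀ i, i ∈ (Finset.range N).image e → D i ⊆ A := fun i hi => by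
        obtain ⟨j, hj, rfl⟩ := Finset.mem_image.1 hi
        exact subset_iUnion₂_of_subset j (Finset.mem_range.1 hj) Subset.rfl
      have hAΩ : A ⊆ Ω := iUnion₂_subset fun j _ => hU ▸ subset_iUnion D (e j)
      have hBΩ : B ⊆ Ω := iUnion₂_subset fun j _ => hU ▸ subset_iUnion D j
      have hcov : Ω ⊆ A ∪ B := by
        rw [← hU]
        refine iUnion_subset fun i => ?_
        by_cases hi : i ∈ (Finset.range N).image e
        · exact (hmemA i hi).trans subset_union_left
        · exact fun y hy => Or.inr (mem_iUnion₂.2 ⟨i, hi, hy⟩)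
      have hAne : (Ω ∩ A).Nonempty := by
        obtain ⟨y, hy⟩ := hne (e 0)
        have hyA : y ∈ A := mem_iUnion₂.2 ⟨0, hN, hy⟩
        exact ⟨y, hAΩ hyA, hyA⟩
      have hBne : (Ω ∩ B).Nonempty := by
        by_contra hcon
        refine hfull (Subset.antisymm hAΩ fun y hy => ?_)
        exact (hcov hy).resolve_right fun hyB => hcon ⟨y, hy, hyB⟩
      -- The listed and unlisted sets have open unions covering the connected `Ω`, so these unions
      -- intersect; an unlisted set through a common point is the next one.
      obtain ⟨y, -, hyA, hyB⟩ := hΩ.isPreconnected A B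
        (isOpen_iUnion fun _ => isOpen_iUnion fun _ => hD _)
        (isOpen_iUnion fun _ => isOpen_iUnion fun _ => hD _) hcov hAne hBne
      obtain ⟨i, hi, hyi⟩ := mem_iUnion₂.1 hyB
      have hlt : ∀ j < N, Function.update e N i j = e j := fun j hj =>
        Function.update_of_ne hj.ne _ _
      have hunion : ∀ m ≤ N, ⋃ j < m, D (Function.update e N i j) = ⋃ j < m, D (e j) :=
        fun m hm => iUnion₂_congr fun j hj => by rw [hlt j (hj.trans_le hm)]
      refine ⟨N + 1, Function.update e N i, Nat.succ_pos N, fun m h0 hm => ?_, Or.inr ?_⟩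
      · rw [hunion m (by omega)]
        rcases (Nat.lt_succ_iff.1 hm).lt_or_eq with hmN | rfl
        · rw [hlt m hmN]
          exact hch m h0 hmN
        · rw [Function.update_self]
          exact ⟨y, hyi, hyA⟩
      · rw [Finset.range_add_one, Finset.image_insert, Function.update_self,
          Finset.image_congr (g := e) (fun j hj => hlt j (by simpa using hj)),
          Finset.card_insert_of_notMem hi]
        omega
  obtain ⟨N, e, hN, hch, h | h⟩ := key (Fintype.card ι + 1)
  · exact ⟨N, e, hN, hch, h⟩
  · exact absurd (Finset.card_le_univ ((Finset.range N).image e)) (by omega)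

theorem exists_isStarshapedChain {Ω : Set E} (hΩ : IsBoundedLipschitzDomain Ω) :
    ∃ (N : ℕ) (R : ℝ) (D : Fin N → Set E), 2 ≤ N ∧ IsStarshapedChain Ω N R D := by
  obtain ⟨ι, _, D, R, hR, hopen, hstar, hU⟩ := exists_finite_starshaped_cover hΩ
  have hconn : ∀ i, IsConnected (D i) := fun i => (hstar i).choose_spec.isConnected
  obtain ⟨N, e, hN, hch, hcov⟩ := exists_chain_listing hΩ.isConnected D hopen
    (fun i => (hconn i).nonempty) hU
  have hsub : ∀ i, D i ⊆ Ω := fun i => hU ▸ subset_iUnion D i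
  have hne : Ω.Nonempty := hΩ.isConnected.nonempty
  -- the first set is listed twice, so that the chain has at least two members
  refine ⟨N + 1, R, fun i => D (e (i.val - 1)), by omega, hR, fun i => hopen _, fun i => hconn _,
    fun i => hΩ.isBounded.subset (hsub _), fun i => hstar _, fun i hi => ?_, ?_⟩
  · rcases Nat.lt_or_ge 1 i.val with h1 | h1
    · obtain ⟨y, hy, hy'⟩ := hch (i.val - 1) (by omega) (by omega)
      obtain ⟨j, hj, hyj⟩ := mem_iUnion₂.1 hy'
      refine ⟨y, hy, mem_iUnion₂.2 ⟨⟨j + 1, by omega⟩, ?_, ?_⟩⟩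
      · rw [Fin.lt_def]
        simp only
        omega
      · simpa using hyj
    -- Truncated subtraction gives indices `0` and `1` the same set `D (e 0)`, so their overlap is
    -- the whole set.
    · obtain ⟨y, hy⟩ := (hconn (e 0)).nonempty
      refine ⟨y, by rwa [show i.val - 1 = 0 by omega],
        mem_iUnion₂.2 ⟨⟨0, by omega⟩, Fin.lt_def.2 hi, hy⟩⟩
  · refine Subset.antisymm (iUnion_subset fun i => hsub _) fun y hy => ?_
    rw [← hcov] at hy
    obtain ⟨j, hj, hyj⟩ := mem_iUnion₂.1 hy
    exact mem_iUnion.2 ⟨⟨j + 1, by omega⟩, by simpa using hyj⟩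

end Decomposition

/-! ### Riesz potentials and averages over segments. -/

section Riesz

open scoped ENNReal

variable {n : ℕ}

local notation "E" => EuclideanSpace ℝ (Fin n)

theorem unitBallVolume_pos (n : ℕ) : 0 < unitBallVolume n :=
  ENNReal.toReal_pos (Metric.measure_ball_pos volume _ one_pos).ne' measure_ball_lt_top.ne

/-- The kernel `‖v‖ ^ (1 - n)` of the Riesz potential of order one. -/
noncomputable def rieszKernel (v : EuclideanSpace ℝ (Fin n)) : ℝ≥0∞ :=
  ENNReal.ofReal (‖v‖ ^ (n - 1))⁻¹

@[fun_prop]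
theorem measurable_rieszKernel : Measurable (rieszKernel (n := n)) := by
  unfold rieszKernel
  fun_prop

/-- In polar coordinates the Jacobian `r ^ (n - 1)` cancels the kernel. -/
theorem lintegral_indicator_ball_rieszKernel (hn : 1 ≤ n) {ρ : ℝ} (hρ : 0 < ρ) :
    ∫⁻ v : E, (Metric.ball (0 : E) ρ).indicator rieszKernel v
      = ENNReal.ofReal (n * unitBallVolume n * ρ) := by
  have : Nonempty (Fin n) := ⟨⟨0, hn⟩⟩
  have hdim : Module.finrank ℝ E = n := by simp
  set φ : ℝ → ℝ := (Iio ρ).indicator fun r => (r ^ (n - 1))⁻¹ with hφ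
  have hcongr : ∀ r ∈ Ioi (0 : ℝ), r ^ (Module.finrank ℝ E - 1) • φ r
      = (Ioo 0 ρ).indicator (fun _ => (1 : ℝ)) r := by
    intro r hr
    have hr0 : r ≠ 0 := (mem_Ioi.1 hr).ne'
    rw [hdim, hφ]
    by_cases h : r < ρ
    · rw [indicator_of_mem (show r ∈ Iio ρ from h), indicator_of_mem (show r ∈ Ioo 0 ρ from ⟨hr, h⟩),
        smul_eq_mul, mul_inv_cancel₀ (pow_ne_zero _ hr0)]
    · rw [indicator_of_notMem (show r ∉ Iio ρ from h),
        indicator_of_notMem (fun h' : r ∈ Ioo 0 ρ => h h'.2), smul_zero]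
  have hint1 : Integrable ((Ioo 0 ρ).indicator fun _ => (1 : ℝ)) :=
    (integrable_indicator_iff measurableSet_Ioo).2 (integrableOn_const (by simp))
  have hint : Integrable (fun v : E => φ ‖v‖) := by
    rw [integrable_fun_norm_addHaar volume, integrableOn_congr_fun hcongr measurableSet_Ioi]
    exact hint1.integrableOn
  have hval : ∫ v : E, φ ‖v‖ = n * unitBallVolume n * ρ := by
    rw [integral_fun_norm_addHaar volume φ, setIntegral_congr_fun measurableSet_Ioi hcongr,
      setIntegral_indicator measurableSet_Ioo,
      inter_eq_self_of_subset_right Ioo_subset_Ioi_self, hdim]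
    simp [unitBallVolume, hρ.le, mul_assoc]
  rw [← hval, ofReal_integral_eq_lintegral_ofReal hint]
  · refine lintegral_congr fun v => ?_
    by_cases h : ‖v‖ < ρ
    · rw [hφ, indicator_of_mem (by simpa using h : v ∈ Metric.ball (0 : E) ρ),
        indicator_of_mem (show ‖v‖ ∈ Iio ρ from h)]
      rfl
    · rw [hφ, indicator_of_notMem (by simpa using h : v ∉ Metric.ball (0 : E) ρ),
        indicator_of_notMem (show ‖v‖ ∉ Iio ρ from h), ENNReal.ofReal_zero]
  · refine Filter.Eventually.of_forall fun v => ?_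
    by_cases h : ‖v‖ < ρ
    · simp only [hφ, indicator_of_mem (show ‖v‖ ∈ Iio ρ from h), Pi.zero_apply]
      positivity
    · simp [hφ, indicator_of_notMem (show ‖v‖ ∉ Iio ρ from h)]

/-- Here `ρ` is the radius of a ball with the volume of `Ω`. The ball of radius `ρ` about `z`
contributes at most `n ω_n ρ`; outside it the kernel is at most `ρ ^ (1 - n)`, which contributes at
most `ω_n ρ`. This is the source of the factor `n + 1`. -/
theorem lintegral_rieszKernel_le_of_radius (hn : 1 ≤ n) {ρ : ℝ} (hρ : 0 < ρ) (Ω : Set E)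
    (hvol : volume Ω = ENNReal.ofReal (unitBallVolume n * ρ ^ n)) (z : E) :
    ∫⁻ y in Ω, rieszKernel (z - y) ≤ ENNReal.ofReal ((n + 1) * (unitBallVolume n * ρ)) := by
  have hω := unitBallVolume_pos n
  have hpt : ∀ y : E, rieszKernel (z - y) ≤
      (Metric.ball (0 : E) ρ).indicator rieszKernel (z - y) + ENNReal.ofReal (ρ ^ (n - 1))⁻¹ := by
    intro y
    by_cases h : z - y ∈ Metric.ball (0 : E) ρ
    · rw [indicator_of_mem h]
      exact le_self_add
    · rw [indicator_of_notMem h, zero_add]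
      rw [mem_ball_zero_iff, not_lt] at h
      exact ENNReal.ofReal_le_ofReal (by gcongr)
  have hmeas : Measurable ((Metric.ball (0 : E) ρ).indicator (rieszKernel (n := n))) :=
    measurable_rieszKernel.indicator Metric.isOpen_ball.measurableSet
  calc ∫⁻ y in Ω, rieszKernel (z - y)
      ≤ ∫⁻ y in Ω, ((Metric.ball (0 : E) ρ).indicator rieszKernel (z - y)
          + ENNReal.ofReal (ρ ^ (n - 1))⁻¹) := lintegral_mono hpt
    _ = (∫⁻ y in Ω, (Metric.ball (0 : E) ρ).indicator rieszKernel (z - y))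
          + ENNReal.ofReal (ρ ^ (n - 1))⁻¹ * volume Ω := by
        rw [lintegral_add_right _ measurable_const, setLIntegral_const]
    _ ≤ (∫⁻ y, (Metric.ball (0 : E) ρ).indicator rieszKernel (z - y))
          + ENNReal.ofReal (ρ ^ (n - 1))⁻¹ * volume Ω := by
        exact add_le_add_left (setLIntegral_le_lintegral _ _) _
    _ = ENNReal.ofReal (n * unitBallVolume n * ρ)
          + ENNReal.ofReal (ρ ^ (n - 1))⁻¹ * ENNReal.ofReal (unitBallVolume n * ρ ^ n) := by
        rw [lintegral_sub_left_eq_self (fun v => (Metric.ball (0 : E) ρ).indicator rieszKernel v) z,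
          lintegral_indicator_ball_rieszKernel hn hρ, hvol]
    _ = ENNReal.ofReal ((n + 1) * (unitBallVolume n * ρ)) := by
        rw [← ENNReal.ofReal_mul (by positivity), ← ENNReal.ofReal_add (by positivity)
          (by positivity)]
        congr 1
        obtain ⟨m, rfl⟩ := Nat.exists_eq_add_of_le' hn
        rw [Nat.add_sub_cancel, pow_succ ρ m]
        field_simp

theorem lintegral_rieszKernel_le (hn : 1 ≤ n) {Ω : Set E} (h0 : volume Ω ≠ 0)
    (htop : volume Ω ≠ ⊤) (z : E) :
    ∫⁻ y in Ω, rieszKernel (z - y) ≤ ENNReal.ofReal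
      ((n + 1) * (unitBallVolume n ^ (1 - 1 / (n : ℝ)) * volume.real Ω ^ (1 / (n : ℝ)))) := by
  have hω := unitBallVolume_pos n
  have hv : 0 < volume.real Ω := ENNReal.toReal_pos h0 htop
  have hn0 : (n : ℝ) ≠ 0 := by positivity
  set ρ : ℝ := (volume.real Ω / unitBallVolume n) ^ (1 / (n : ℝ)) with hρ
  have hρpos : 0 < ρ := by positivity
  have hpow : ρ ^ n = volume.real Ω / unitBallVolume n := by
    rw [hρ, ← Real.rpow_natCast, ← Real.rpow_mul (by positivity), one_div_mul_cancel hn0,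
      Real.rpow_one]
  have hωρ : unitBallVolume n * ρ
      = unitBallVolume n ^ (1 - 1 / (n : ℝ)) * volume.real Ω ^ (1 / (n : ℝ)) := by
    rw [hρ, Real.div_rpow hv.le hω.le, Real.rpow_sub hω, Real.rpow_one]
    ring
  rw [← hωρ]
  refine lintegral_rieszKernel_le_of_radius hn hρpos Ω ?_ z
  rw [hpow, mul_div_cancel₀ _ hω.ne', measureReal_def, ENNReal.ofReal_toReal htop]

/-- `‖v‖ ^ p`, cut off at radius `d`. -/
noncomputable def truncNormRpow (p d : ℝ) (v : EuclideanSpace ℝ (Fin n)) : ℝ≥0∞ :=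
  (Metric.closedBall 0 d).indicator (fun v => ENNReal.ofReal (‖v‖ ^ p)) v

@[fun_prop]
theorem measurable_truncNormRpow (p d : ℝ) : Measurable (truncNormRpow (n := n) p d) := by
  unfold truncNormRpow
  refine Measurable.indicator ?_ Metric.isClosed_closedBall.measurableSet
  fun_prop

/-- The cut-off forces `t ≥ ‖v‖ / d`, which keeps the integral of `t ^ (-(n + p))` away from its
singularity. Its exact value has the denominator `n + p - 1`, weakened to `n`. -/
theorem lintegral_truncNormRpow_le (hn : 1 ≤ n) {p d : ℝ} (hp : 1 ≤ p) (hd : 0 < d) (v : E) :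
    ∫⁻ t in Ioo (0 : ℝ) 1, ENNReal.ofReal (t ^ n)⁻¹ * truncNormRpow p d (t⁻¹ • v)
      ≤ ENNReal.ofReal (d ^ ((n : ℝ) + p - 1) / n) * rieszKernel v := by
  have hn1 : (1 : ℝ) ≤ n := by exact_mod_cast hn
  rcases eq_or_ne v 0 with rfl | hv
  · have : truncNormRpow p d (0 : E) = 0 := by
      simp [truncNormRpow, Real.zero_rpow (by linarith : p ≠ 0)]
    simp [this]
  set r : ℝ := ‖v‖ with hr
  have hrpos : 0 < r := norm_pos_iff.2 hv
  have hrd : 0 < r / d := by positivity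
  have hpt : ∀ t ∈ Ioo (0 : ℝ) 1, ENNReal.ofReal (t ^ n)⁻¹ * truncNormRpow p d (t⁻¹ • v)
      ≤ (Ici (r / d)).indicator
        (fun t => ENNReal.ofReal (r ^ p) * ENNReal.ofReal (t ^ (-((n : ℝ) + p)))) t := by
    intro t ht
    have ht0 : 0 < t := ht.1
    have hnorm : ‖t⁻¹ • v‖ = r / t := by
      rw [norm_smul, norm_inv, Real.norm_of_nonneg ht0.le, inv_mul_eq_div]
    unfold truncNormRpow
    by_cases h : t⁻¹ • v ∈ Metric.closedBall (0 : E) d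
    · have ht' : t ∈ Ici (r / d) := by
        rw [mem_closedBall_zero_iff, hnorm, div_le_iff₀ ht0] at h
        rw [mem_Ici, div_le_iff₀ hd]
        linarith
      rw [indicator_of_mem h, indicator_of_mem ht', hnorm, ← ENNReal.ofReal_mul (by positivity),
        ← ENNReal.ofReal_mul (by positivity)]
      refine le_of_eq ?_
      congr 1
      rw [Real.div_rpow hrpos.le ht0.le, Real.rpow_neg ht0.le, Real.rpow_add ht0,
        Real.rpow_natCast]
      field_simp
    · rw [indicator_of_notMem h, mul_zero]
      exact zero_le
  have hlt : -((n : ℝ) + p) < -1 := by linarith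
  calc ∫⁻ t in Ioo (0 : ℝ) 1, ENNReal.ofReal (t ^ n)⁻¹ * truncNormRpow p d (t⁻¹ • v)
      ≤ ∫⁻ t in Ioo (0 : ℝ) 1, (Ici (r / d)).indicator
        (fun t => ENNReal.ofReal (r ^ p) * ENNReal.ofReal (t ^ (-((n : ℝ) + p)))) t :=
        setLIntegral_mono' measurableSet_Ioo hpt
    _ ≤ ∫⁻ t, (Ici (r / d)).indicator
        (fun t => ENNReal.ofReal (r ^ p) * ENNReal.ofReal (t ^ (-((n : ℝ) + p)))) t :=
        setLIntegral_le_lintegral _ _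
    _ = ENNReal.ofReal (r ^ p) * ∫⁻ t in Ioi (r / d), ENNReal.ofReal (t ^ (-((n : ℝ) + p))) := by
        rw [lintegral_indicator measurableSet_Ici, setLIntegral_congr Ioi_ae_eq_Ici.symm,
          lintegral_const_mul _ (by fun_prop)]
    _ = ENNReal.ofReal (r ^ p)
          * ENNReal.ofReal (-(r / d) ^ (-((n : ℝ) + p) + 1) / (-((n : ℝ) + p) + 1)) := by
        rw [← integral_Ioi_rpow_of_lt hlt hrd, ofReal_integral_eq_lintegral_ofReal
          (integrableOn_Ioi_rpow_of_lt hlt hrd)]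
        filter_upwards [ae_restrict_mem measurableSet_Ioi] with t ht
        exact Real.rpow_nonneg (hrd.le.trans (mem_Ioi.1 ht).le) _
    _ = ENNReal.ofReal (d ^ ((n : ℝ) + p - 1) / (n + p - 1)) * rieszKernel v := by
        unfold rieszKernel
        rw [← ENNReal.ofReal_mul (by positivity), ← ENNReal.ofReal_mul
          (div_nonneg (by positivity) (by linarith)), ← hr]
        congr 1
        have h1 : -((n : ℝ) + p) + 1 = -((n : ℝ) + p - 1) := by ring
        have h2 : (n : ℝ) + p - 1 = p + ((n - 1 : ℕ) : ℝ) := by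
          rw [Nat.cast_sub hn]
          push_cast
          ring
        have h3 : (n : ℝ) + p - 1 ≠ 0 := by linarith
        rw [h1, Real.rpow_neg hrd.le, Real.div_rpow hrpos.le hd.le, neg_div_neg_eq]
        have h4 : r ^ ((n : ℝ) + p - 1) = r ^ p * r ^ (n - 1) := by
          rw [h2, Real.rpow_add hrpos, Real.rpow_natCast]
        rw [h4]
        have h5 : r ^ p ≠ 0 := by positivity
        field_simp
    _ ≤ ENNReal.ofReal (d ^ ((n : ℝ) + p - 1) / n) * rieszKernel v := by
        gcongr
        linarith

/-- Averages of `G` over segments, weighted with a power of the length of the segment, are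
controlled by the Riesz potential of `G`. -/
theorem lintegral_lintegral_segment_le (hn : 1 ≤ n) {p d : ℝ} (hp : 1 ≤ p) (hd : 0 < d)
    {G : E → ℝ≥0∞} (hG : Measurable G) {D S : Set E} (hS : MeasurableSet S) (hD : MeasurableSet D)
    (hdiam : ∀ y ∈ D, ∀ x ∈ S, ‖x - y‖ ≤ d) {A : ℝ≥0∞}
    (hA : ∀ z, ∫⁻ y in D, rieszKernel (z - y) ≤ A) :
    ∫⁻ y in D, ∫⁻ x in S, ∫⁻ t in Ioo (0 : ℝ) 1,
        ENNReal.ofReal (‖x - y‖ ^ p) * G (y + t • (x - y))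
      ≤ ENNReal.ofReal (d ^ ((n : ℝ) + p - 1) / n) * A * ∫⁻ z, G z := by
  set c : ℝ≥0∞ := ENNReal.ofReal (d ^ ((n : ℝ) + p - 1) / n) with hc
  -- On `S` the truncated weight agrees with the original one, so `x` may then range over the whole
  -- space. Substituting `v = t • (x - y)`, with Jacobian `t ^ (-n)`, frees `G` of `t`, and the
  -- integral in `t` collapses to the kernel.
  have hinner : ∀ y ∈ D, ∫⁻ x in S, ∫⁻ t in Ioo (0 : ℝ) 1,
      ENNReal.ofReal (‖x - y‖ ^ p) * G (y + t • (x - y))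
        ≤ c * ∫⁻ z, rieszKernel (z - y) * G z := by
    intro y hy
    calc ∫⁻ x in S, ∫⁻ t in Ioo (0 : ℝ) 1, ENNReal.ofReal (‖x - y‖ ^ p) * G (y + t • (x - y))
        = ∫⁻ x in S, ∫⁻ t in Ioo (0 : ℝ) 1,
            truncNormRpow p d (x - y) * G (y + t • (x - y)) := by
          refine setLIntegral_congr_fun hS fun x hx => ?_
          have : x - y ∈ Metric.closedBall (0 : E) d :=
            mem_closedBall_zero_iff.2 (hdiam y hy x hx)
          simp only [truncNormRpow, indicator_of_mem this]
      _ ≤ ∫⁻ x, ∫⁻ t in Ioo (0 : ℝ) 1, truncNormRpow p d (x - y) * G (y + t • (x - y)) :=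
          setLIntegral_le_lintegral _ _
      _ = ∫⁻ u : E, ∫⁻ t in Ioo (0 : ℝ) 1, truncNormRpow p d u * G (y + t • u) :=
          lintegral_sub_right_eq_self
            (fun u => ∫⁻ t in Ioo (0 : ℝ) 1, truncNormRpow p d u * G (y + t • u)) y
      _ = ∫⁻ t in Ioo (0 : ℝ) 1, ∫⁻ u : E, truncNormRpow p d u * G (y + t • u) := by
          refine lintegral_lintegral_swap (Measurable.aemeasurable ?_)
          fun_prop
      _ = ∫⁻ t in Ioo (0 : ℝ) 1, ∫⁻ v : E,
            ENNReal.ofReal (t ^ n)⁻¹ * truncNormRpow p d (t⁻¹ • v) * G (y + v) := by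
          refine setLIntegral_congr_fun measurableSet_Ioo fun t ht => ?_
          have ht0 : t ≠ 0 := ht.1.ne'
          have hmeas : Measurable fun v : E => truncNormRpow p d (t⁻¹ • v) * G (y + v) := by
            fun_prop
          calc ∫⁻ u : E, truncNormRpow p d u * G (y + t • u)
              = ∫⁻ u : E, (fun v => truncNormRpow p d (t⁻¹ • v) * G (y + v)) (t • u) := by
                simp only [smul_smul, inv_mul_cancel₀ ht0, one_smul]
            _ = ∫⁻ v, truncNormRpow p d (t⁻¹ • v) * G (y + v)
                  ∂(Measure.map (t • ·) (volume : Measure E)) :=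
                (lintegral_map hmeas (measurable_const_smul t)).symm
            _ = ENNReal.ofReal (t ^ n)⁻¹ * ∫⁻ v : E, truncNormRpow p d (t⁻¹ • v) * G (y + v) := by
                rw [Measure.map_addHaar_smul _ ht0, lintegral_smul_measure, smul_eq_mul,
                  finrank_euclideanSpace_fin, abs_of_nonneg
                  (inv_nonneg.2 (pow_nonneg ht.1.le n))]
            _ = _ := by
                rw [← lintegral_const_mul _ hmeas]
                simp only [mul_assoc]
      _ = ∫⁻ v : E, ∫⁻ t in Ioo (0 : ℝ) 1,
            ENNReal.ofReal (t ^ n)⁻¹ * truncNormRpow p d (t⁻¹ • v) * G (y + v) := by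
          refine lintegral_lintegral_swap (Measurable.aemeasurable ?_)
          fun_prop
      _ ≤ ∫⁻ v : E, c * (rieszKernel v * G (y + v)) := by
          refine lintegral_mono fun v => ?_
          rw [lintegral_mul_const _ (by fun_prop), ← mul_assoc]
          gcongr
          exact lintegral_truncNormRpow_le hn hp hd v
      _ = c * ∫⁻ v : E, rieszKernel v * G (y + v) := lintegral_const_mul _ (by fun_prop)
      _ = c * ∫⁻ z, rieszKernel (z - y) * G z := by
          rw [← lintegral_sub_right_eq_self (fun v => rieszKernel v * G (y + v)) y]
          simp only [add_sub_cancel]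
  calc _ ≤ ∫⁻ y in D, c * ∫⁻ z, rieszKernel (z - y) * G z := setLIntegral_mono' hD hinner
    _ = c * ∫⁻ y in D, ∫⁻ z, rieszKernel (z - y) * G z := by
        refine lintegral_const_mul _ (Measurable.lintegral_prod_right' (f := fun q : E × E =>
          rieszKernel (q.2 - q.1) * G q.2) ?_)
        fun_prop
    _ = c * ∫⁻ z, ∫⁻ y in D, rieszKernel (z - y) * G z := by
        congr 1
        refine lintegral_lintegral_swap (Measurable.aemeasurable ?_)
        fun_prop
    _ ≤ c * ∫⁻ z, A * G z := by
        gcongr with z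
        rw [lintegral_mul_const _ (by fun_prop)]
        gcongr
        exact hA z
    _ = c * A * ∫⁻ z, G z := by rw [lintegral_const_mul _ hG, mul_assoc]

end Riesz

/-! ### Jensen's inequality for powers. -/

section Jensen

open scoped ENNReal

variable {α : Type*} [MeasurableSpace α] {μ : Measure α}

/-- On a probability space the `L¹` norm is at most the `Lᵖ` norm. -/
theorem enorm_integral_rpow_le [IsProbabilityMeasure μ] {h : α → ℝ}
    (hh : AEStronglyMeasurable h μ) {p : ℝ} (hp : 1 ≤ p) :
    ‖∫ a, h a ∂μ‖ₑ ^ p ≤ ∫⁻ a, ‖h a‖ₑ ^ p ∂μ := by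
  have hp0 : 0 < p := by linarith
  have hne0 : ENNReal.ofReal p ≠ 0 := by simpa using hp0
  have h1 : eLpNorm h 1 μ ≤ eLpNorm h (ENNReal.ofReal p) μ :=
    eLpNorm_le_eLpNorm_of_exponent_le (by simpa using hp) hh
  rw [eLpNorm_one_eq_lintegral_enorm, eLpNorm_eq_lintegral_rpow_enorm_toReal hne0
    ENNReal.ofReal_ne_top, ENNReal.toReal_ofReal hp0.le] at h1
  calc ‖∫ a, h a ∂μ‖ₑ ^ p ≤ ((∫⁻ a, ‖h a‖ₑ ^ p ∂μ) ^ (1 / p)) ^ p := by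
        gcongr
        exact (enorm_integral_le_lintegral_enorm h).trans h1
    _ = ∫⁻ a, ‖h a‖ₑ ^ p ∂μ := by
        rw [← ENNReal.rpow_mul, one_div_mul_cancel hp0.ne', ENNReal.rpow_one]

theorem enorm_average_rpow_le [IsFiniteMeasure μ] [NeZero μ] {h : α → ℝ}
    (hh : AEStronglyMeasurable h μ) {p : ℝ} (hp : 1 ≤ p) :
    ‖⨍ a, h a ∂μ‖ₑ ^ p ≤ (μ univ)⁻¹ * ∫⁻ a, ‖h a‖ₑ ^ p ∂μ := by
  have := enorm_integral_rpow_le (μ := (μ univ)⁻¹ • μ) (h := h) (hh.smul_measure _) hp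
  rwa [lintegral_smul_measure, smul_eq_mul] at this

end Jensen

/-! ### Double integrals of differences and their propagation along a chain. -/

section Oscillation

open scoped ENNReal

variable {α : Type*} [MeasurableSpace α] {μ : Measure α}

/-- The double integral of `|g x - g y| ^ p` over `x ∈ A`, `y ∈ B`. -/
noncomputable def oscInt (μ : Measure α) (p : ℝ) (g : α → ℝ) (A B : Set α) : ℝ≥0∞ :=
  ∫⁻ x in A, ∫⁻ y in B, ‖g x - g y‖ₑ ^ p ∂μ ∂μ

theorem oscInt_mono (p : ℝ) (g : α → ℝ) {A A' B B' : Set α} (hA : A ⊆ A') (hB : B ⊆ B') :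
    oscInt μ p g A B ≤ oscInt μ p g A' B' :=
  (lintegral_mono_set hA).trans (lintegral_mono fun _ => lintegral_mono_set hB)

variable [SFinite μ]

theorem oscInt_comm {g : α → ℝ} (hg : Measurable g) (p : ℝ) (A B : Set α) :
    oscInt μ p g A B = oscInt μ p g B A := by
  unfold oscInt
  rw [lintegral_lintegral_swap (Measurable.aemeasurable (by fun_prop))]
  simp only [enorm_sub_rev]

theorem oscInt_union_le {g : α → ℝ} (hg : Measurable g) (p : ℝ) (A B : Set α) :
    oscInt μ p g (A ∪ B) (A ∪ B)
      ≤ oscInt μ p g A A + oscInt μ p g B B + 2 * oscInt μ p g A B := by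
  have hmeas : ∀ C : Set α, Measurable fun x => ∫⁻ y in C, ‖g x - g y‖ₑ ^ p ∂μ := fun C =>
    Measurable.lintegral_prod_right' (f := fun q : α × α => ‖g q.1 - g q.2‖ₑ ^ p) (by fun_prop)
  have h1 : ∀ C : Set α, oscInt μ p g C (A ∪ B) ≤ oscInt μ p g C A + oscInt μ p g C B := by
    intro C
    unfold oscInt
    rw [← lintegral_add_left (hmeas A)]
    exact lintegral_mono fun x => lintegral_union_le _ _ _
  calc oscInt μ p g (A ∪ B) (A ∪ B)
      ≤ oscInt μ p g A (A ∪ B) + oscInt μ p g B (A ∪ B) := lintegral_union_le _ _ _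
    _ ≤ (oscInt μ p g A A + oscInt μ p g A B) + (oscInt μ p g B A + oscInt μ p g B B) :=
        add_le_add (h1 A) (h1 B)
    _ = _ := by
        rw [oscInt_comm hg p B A]
        ring

/-- Comparison of values on `A` and on `B` through values on `W`. -/
theorem measure_mul_oscInt_le {g : α → ℝ} (hg : Measurable g) {p : ℝ} (hp : 1 ≤ p)
    (A B W : Set α) : μ W * oscInt μ p g A B
      ≤ 2 ^ (p - 1) * (μ B * oscInt μ p g A W + μ A * oscInt μ p g W B) := by
  have hmeas : Measurable fun q : α × α => ‖g q.1 - g q.2‖ₑ ^ p := by fun_prop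
  -- Any single `z` serves as an intermediate point, by convexity of the `p`-th power; integrating
  -- over `z ∈ W` produces the factor `μ W`.
  have hz : ∀ z, oscInt μ p g A B ≤ 2 ^ (p - 1) *
      (μ B * ∫⁻ x in A, ‖g x - g z‖ₑ ^ p ∂μ + μ A * ∫⁻ y in B, ‖g z - g y‖ₑ ^ p ∂μ) := by
    intro z
    have hpt : ∀ x y, ‖g x - g y‖ₑ ^ p
        ≤ 2 ^ (p - 1) * (‖g x - g z‖ₑ ^ p + ‖g z - g y‖ₑ ^ p) := by
      intro x y
      refine le_trans ?_ (ENNReal.rpow_add_le_mul_rpow_add_rpow _ _ hp)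
      gcongr
      rw [← sub_add_sub_cancel (g x) (g z) (g y)]
      exact enorm_add_le _ _
    calc oscInt μ p g A B
        ≤ ∫⁻ x in A, ∫⁻ y in B, 2 ^ (p - 1) * (‖g x - g z‖ₑ ^ p + ‖g z - g y‖ₑ ^ p) ∂μ ∂μ :=
          lintegral_mono fun x => lintegral_mono fun y => hpt x y
      _ = ∫⁻ x in A, 2 ^ (p - 1) *
            (‖g x - g z‖ₑ ^ p * μ B + ∫⁻ y in B, ‖g z - g y‖ₑ ^ p ∂μ) ∂μ := by
          refine lintegral_congr fun x => ?_
          rw [lintegral_const_mul _ (by fun_prop), lintegral_add_left measurable_const,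
            setLIntegral_const]
      _ = _ := by
          rw [lintegral_const_mul _ (by fun_prop), lintegral_add_right _ measurable_const,
            setLIntegral_const, lintegral_mul_const _ (by fun_prop)]
          ring
  calc μ W * oscInt μ p g A B = ∫⁻ _ in W, oscInt μ p g A B ∂μ := by
        rw [setLIntegral_const, mul_comm]
    _ ≤ ∫⁻ z in W, 2 ^ (p - 1) * (μ B * ∫⁻ x in A, ‖g x - g z‖ₑ ^ p ∂μ
          + μ A * ∫⁻ y in B, ‖g z - g y‖ₑ ^ p ∂μ) ∂μ := lintegral_mono hz
    _ = 2 ^ (p - 1) * (μ B * oscInt μ p g W A + μ A * oscInt μ p g W B) := by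
        have h1 : Measurable fun z => ∫⁻ x in A, ‖g x - g z‖ₑ ^ p ∂μ :=
          hmeas.lintegral_prod_left'
        have h2 : Measurable fun z => ∫⁻ y in B, ‖g z - g y‖ₑ ^ p ∂μ :=
          hmeas.lintegral_prod_right'
        rw [lintegral_const_mul _ (by fun_prop), lintegral_add_left (by fun_prop),
          lintegral_const_mul _ h1, lintegral_const_mul _ h2]
        unfold oscInt
        simp only [enorm_sub_rev]
    _ = _ := by rw [oscInt_comm hg p W A]

/-- Propagation of oscillation bounds along a chain of sets. -/
theorem oscInt_chain_le {g : α → ℝ} (hg : Measurable g) {p : ℝ} (hp : 1 ≤ p) {Ω : Set α}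
    {N : ℕ} {D : ℕ → Set α} (hDΩ : ∀ i < N, D i ⊆ Ω) {l q M : ℝ≥0∞} (hl0 : l ≠ 0) (hl : l ≠ ⊤)
    (hq : 2 ^ p * μ Ω ≤ q * l) (hoverlap : ∀ i, 0 < i → i < N → l ≤ μ (D i ∩ ⋃ j < i, D j))
    (hD : ∀ i < N, oscInt μ p g (D i) (D i) ≤ q * M)
    {k : ℕ} (hk : 0 < k) (hkN : k ≤ N) :
    oscInt μ p g (⋃ j < k, D j) (⋃ j < k, D j) + M ≤ M * (1 + 2 * q) ^ k := by
  -- The added `M` turns the affine recursion for the oscillation into a geometric one with ratio `1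
  -- + 2 * q`.
  induction k, hk using Nat.le_induction with
  | base =>
    have : ⋃ j < 1, D j = D 0 := by simp
    rw [this, pow_one]
    calc oscInt μ p g (D 0) (D 0) + M ≤ q * M + M := by
          gcongr
          exact hD 0 hkN
      _ ≤ q * M + M + q * M := le_self_add
      _ = M * (1 + 2 * q) := by ring
  | succ k hk ih =>
    set U : Set α := ⋃ j < k, D j with hU
    have hUsucc : ⋃ j < k + 1, D j = U ∪ D k := by
      rw [biUnion_lt_succ]
    have hUΩ : U ⊆ Ω := iUnion₂_subset fun j hj => hDΩ j (by omega)
    have hDk := hDΩ k (by omega)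
    -- The overlap `D k ∩ U` is the intermediate set: it lies in both sets, so each leg is an
    -- oscillation within one of them. Its measure is at least `l`, which is then cancelled.
    have hcross : 2 * oscInt μ p g U (D k)
        ≤ q * (oscInt μ p g U U + oscInt μ p g (D k) (D k)) := by
      have h1 : l * (2 * oscInt μ p g U (D k))
          ≤ l * (q * (oscInt μ p g U U + oscInt μ p g (D k) (D k))) := by
        calc l * (2 * oscInt μ p g U (D k))
            ≤ μ (D k ∩ U) * (2 * oscInt μ p g U (D k)) := by
              gcongr
              exact hoverlap k hk (by omega)
          _ = 2 * (μ (D k ∩ U) * oscInt μ p g U (D k)) := by ring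
          _ ≤ 2 * (2 ^ (p - 1) * (μ (D k) * oscInt μ p g U (D k ∩ U)
                + μ U * oscInt μ p g (D k ∩ U) (D k))) := by
              exact mul_le_mul' le_rfl (measure_mul_oscInt_le hg hp _ _ _)
          _ ≤ 2 * (2 ^ (p - 1) * (μ Ω * oscInt μ p g U U
                + μ Ω * oscInt μ p g (D k) (D k))) := by
              gcongr
              · exact oscInt_mono (μ := μ) p g Subset.rfl inter_subset_right
              · exact oscInt_mono (μ := μ) p g inter_subset_left Subset.rfl
          _ = (2 ^ p * μ Ω) * (oscInt μ p g U U + oscInt μ p g (D k) (D k)) := by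
              have h2 : (2 : ℝ≥0∞) ^ p = 2 * 2 ^ (p - 1) := by
                conv_lhs => rw [show p = 1 + (p - 1) by ring]
                rw [ENNReal.rpow_add _ _ (by norm_num) (by norm_num), ENNReal.rpow_one]
              rw [h2]
              ring
          _ ≤ (q * l) * (oscInt μ p g U U + oscInt μ p g (D k) (D k)) := by gcongr
          _ = _ := by ring
      exact (ENNReal.mul_le_mul_iff_right hl0 hl).1 h1
    have hih := ih (by omega)
    have hqk : q ≤ (1 + 2 * q) ^ k := by
      calc q ≤ q + (1 + q) := le_self_add
        _ = 1 + 2 * q := by ring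
        _ ≤ (1 + 2 * q) ^ k := le_self_pow₀ le_self_add (by omega)
    rw [hUsucc]
    calc oscInt μ p g (U ∪ D k) (U ∪ D k) + M
        ≤ oscInt μ p g U U + oscInt μ p g (D k) (D k)
            + q * (oscInt μ p g U U + oscInt μ p g (D k) (D k)) + M := by
          gcongr
          exact (oscInt_union_le (μ := μ) hg p _ _).trans (by gcongr)
      _ ≤ oscInt μ p g U U + q * M + q * (oscInt μ p g U U + q * M) + M := by
          gcongr <;> exact hD k (by omega)
      _ = (1 + q) * (oscInt μ p g U U + M) + q * (M * q) := by ring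
      _ ≤ (1 + q) * (M * (1 + 2 * q) ^ k) + q * (M * (1 + 2 * q) ^ k) := by gcongr
      _ = M * (1 + 2 * q) ^ (k + 1) := by ring

end Oscillation

/-! ### Differences of values bounded by the gradient along a segment. -/

section Segment

open scoped ENNReal

variable {n : ℕ}

local notation "E" => EuclideanSpace ℝ (Fin n)

/-- `‖∇f‖ ^ p` in `Ω`, extended by zero. -/
noncomputable def gradRpow (Ω : Set (EuclideanSpace ℝ (Fin n)))
    (f : EuclideanSpace ℝ (Fin n) → ℝ) (p : ℝ) : EuclideanSpace ℝ (Fin n) → ℝ≥0∞ :=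
  Ω.indicator fun z => ‖fderiv ℝ f z‖ₑ ^ p

theorem measurable_gradRpow {Ω : Set E} (hΩ : IsOpen Ω) (f : E → ℝ) (p : ℝ) :
    Measurable (gradRpow Ω f p) :=
  ((measurable_fderiv ℝ f).enorm.pow_const p).indicator hΩ.measurableSet

/-- The fundamental theorem of calculus along the segment, followed by Jensen on the unit interval.
-/
theorem enorm_sub_rpow_le_lintegral_segment {Ω : Set E} (hΩ : IsOpen Ω) {f : E → ℝ}
    (hf : ContDiffOn ℝ 1 f Ω) {p : ℝ} (hp : 1 ≤ p) {x y : E} (hxy : segment ℝ y x ⊆ Ω) :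
    ‖f x - f y‖ₑ ^ p ≤ ∫⁻ t in Ioo (0 : ℝ) 1,
      ENNReal.ofReal (‖x - y‖ ^ p) * gradRpow Ω f p (y + t • (x - y)) := by
  have hp0 : 0 ≤ p := by linarith
  have hmem : ∀ t ∈ Icc (0 : ℝ) 1, y + t • (x - y) ∈ Ω := fun t ht => hxy <| by
    rw [segment_eq_image']
    exact ⟨t, ht, rfl⟩
  have hderiv : ∀ t ∈ Icc (0 : ℝ) 1, HasDerivAt (fun t : ℝ => f (y + t • (x - y)))
      (fderiv ℝ f (y + t • (x - y)) (x - y)) t := by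
    intro t ht
    have h1 : HasFDerivAt f (fderiv ℝ f (y + t • (x - y))) (y + t • (x - y)) :=
      ((hf.differentiableOn one_ne_zero).differentiableAt (hΩ.mem_nhds (hmem t ht))).hasFDerivAt
    have h2 : HasDerivAt (fun t : ℝ => y + t • (x - y)) (x - y) t := by
      simpa using ((hasDerivAt_id t).smul_const (x - y)).const_add y
    exact h1.comp_hasDerivAt t h2
  have hcont : ContinuousOn (fun t : ℝ => fderiv ℝ f (y + t • (x - y)) (x - y)) (Icc 0 1) := by
    have h1 : ContinuousOn (fderiv ℝ f) Ω := hf.continuousOn_fderiv_of_isOpen hΩ le_rfl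
    exact (h1.comp (by fun_prop) hmem).clm_apply continuousOn_const
  have hftc : f x - f y = ∫ t in Ioo (0 : ℝ) 1, fderiv ℝ f (y + t • (x - y)) (x - y) := by
    have h1 := intervalIntegral.integral_eq_sub_of_hasDerivAt (a := 0) (b := 1)
      (f := fun t : ℝ => f (y + t • (x - y)))
      (fun t ht => hderiv t (by rwa [uIcc_of_le zero_le_one] at ht))
      (ContinuousOn.intervalIntegrable (by rwa [uIcc_of_le zero_le_one]))
    rw [intervalIntegral.integral_of_le zero_le_one, integral_Ioc_eq_integral_Ioo] at h1
    rw [h1]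
    simp
  have : IsProbabilityMeasure (volume.restrict (Ioo (0 : ℝ) 1)) := ⟨by simp⟩
  rw [hftc]
  refine (enorm_integral_rpow_le ((hcont.mono Ioo_subset_Icc_self).aestronglyMeasurable
    measurableSet_Ioo) hp).trans ?_
  refine setLIntegral_mono' measurableSet_Ioo fun t ht => ?_
  rw [gradRpow, indicator_of_mem (hmem t (Ioo_subset_Icc_self ht)),
    ← ENNReal.ofReal_rpow_of_nonneg (norm_nonneg _) hp0, ofReal_norm,
    ← ENNReal.mul_rpow_of_nonneg _ _ hp0, mul_comm]
  gcongr
  exact ContinuousLinearMap.le_opENorm _ _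

end Segment

/-! ### Assembly of the inequality with its explicit constant. -/

section Chain

open scoped ENNReal

variable {n : ℕ}

local notation "E" => EuclideanSpace ℝ (Fin n)

/-- The continuous extension is bounded on the compact closure. This supplies the integrability that
lets Bochner integrals be exchanged for lower Lebesgue integrals. -/
theorem SmoothUpToBoundary.exists_bound {Ω : Set E} {f : E → ℝ} (hf : SmoothUpToBoundary Ω f)
    (hΩ : Bornology.IsBounded Ω) (k : ℕ) : ∃ M, ∀ x ∈ Ω, ‖iteratedFDeriv ℝ k f x‖ ≤ M := by
  obtain ⟨g, hg, heq⟩ := hf.2 k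
  obtain ⟨M, hM⟩ := hΩ.isCompact_closure.exists_bound_of_continuousOn hg
  exact ⟨M, fun x hx => heq hx ▸ hM x (subset_closure hx)⟩

theorem measurable_indicator_of_continuousOn {Ω : Set E} (hΩ : IsOpen Ω) {f : E → ℝ}
    (hf : ContinuousOn f Ω) : Measurable (Ω.indicator f) := by
  classical
  rw [← piecewise_eq_indicator]
  exact hf.measurable_piecewise continuous_zero.continuousOn hΩ.measurableSet

theorem lintegral_gradRpow {Ω : Set E} (hΩ : IsOpen Ω) (hb : Bornology.IsBounded Ω) {f : E → ℝ}
    (hf : SmoothUpToBoundary Ω f) {p : ℝ} (hp : 0 ≤ p) :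
    ∫⁻ z, gradRpow Ω f p z = ENNReal.ofReal (∫ z in Ω, ‖gradient f z‖ ^ p) := by
  obtain ⟨M, hM⟩ := hf.exists_bound hb 1
  have hnorm : ∀ z, ‖gradient f z‖ = ‖fderiv ℝ f z‖ := fun z => by
    simp [gradient]
  have hint : IntegrableOn (fun z => ‖fderiv ℝ f z‖ ^ p) Ω := by
    refine Measure.integrableOn_of_bounded (M := M ^ p) hb.measure_lt_top.ne
      ((measurable_fderiv ℝ f).norm.pow_const p).aestronglyMeasurable ?_
    filter_upwards [ae_restrict_mem hΩ.measurableSet] with z hz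
    rw [Real.norm_of_nonneg (by positivity)]
    gcongr
    rw [← norm_iteratedFDeriv_one]
    exact hM z hz
  unfold gradRpow
  simp only [hnorm]
  rw [lintegral_indicator hΩ.measurableSet, ofReal_integral_eq_lintegral_ofReal hint
    (Filter.Eventually.of_forall fun z => by positivity)]
  refine lintegral_congr fun z => ?_
  rw [← ENNReal.ofReal_rpow_of_nonneg (norm_nonneg _) hp, ofReal_norm]

/-- The mean deviation is controlled by the double integral of differences. -/
theorem integral_sub_average_rpow_le {Ω : Set E} (hΩ : IsOpen Ω) (hb : Bornology.IsBounded Ω)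
    (hne : Ω.Nonempty) {f : E → ℝ} (hf : SmoothUpToBoundary Ω f) {p : ℝ} (hp : 1 ≤ p) :
    ENNReal.ofReal (∫ x in Ω, |f x - ⨍ y in Ω, f y| ^ p)
      ≤ (volume Ω)⁻¹ * oscInt volume p (Ω.indicator f) Ω Ω := by
  have hp0 : 0 ≤ p := by linarith
  have hfin : volume Ω ≠ ⊤ := hb.measure_lt_top.ne
  have hpos : volume Ω ≠ 0 := (hΩ.measure_pos volume hne).ne'
  -- Off `Ω` the function `f` is arbitrary; its extension by zero is globally measurable.
  set g : E → ℝ := Ω.indicator f with hg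
  have hgm : Measurable g := measurable_indicator_of_continuousOn hΩ hf.1.continuousOn
  have hgf : ∀ x ∈ Ω, g x = f x := fun x hx => indicator_of_mem hx f
  obtain ⟨M, hM⟩ := hf.exists_bound hb 0
  have hgb : ∀ x ∈ Ω, ‖g x‖ ≤ M := fun x hx => by
    rw [hgf x hx, ← norm_iteratedFDeriv_zero (𝕜 := ℝ)]
    exact hM x hx
  have hgi : IntegrableOn g Ω := by
    refine Measure.integrableOn_of_bounded (M := M) hfin hgm.aestronglyMeasurable ?_
    filter_upwards [ae_restrict_mem hΩ.measurableSet] with z hz using hgb z hz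
  set m : ℝ := ⨍ y in Ω, f y with hm
  have hmg : m = ⨍ y in Ω, g y :=
    setAverage_congr_fun hΩ.measurableSet (Filter.Eventually.of_forall fun x hx => (hgf x hx).symm)
  have : IsFiniteMeasure (volume.restrict Ω) := ⟨by simpa using hb.measure_lt_top⟩
  have : NeZero (volume.restrict Ω) := ⟨by simpa using hpos⟩
  -- The deviation from the mean is an average of differences, so Jensen applies to it.
  have hmean : ∀ x, g x - m = ⨍ y in Ω, (g x - g y) := by
    intro x
    have hv : volume.real Ω ≠ 0 := (ENNReal.toReal_pos hpos hfin).ne'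
    rw [hmg, average_eq, average_eq, integral_sub (integrable_const _) hgi, integral_const]
    simp only [measureReal_restrict_apply_univ, smul_eq_mul]
    field_simp
  have hint : IntegrableOn (fun x => |f x - m| ^ p) Ω := by
    have h1 : IntegrableOn (fun x => |g x - m| ^ p) Ω := by
      refine Measure.integrableOn_of_bounded (M := (M + |m|) ^ p) hfin
        (by fun_prop : Measurable fun x => |g x - m| ^ p).aestronglyMeasurable ?_
      filter_upwards [ae_restrict_mem hΩ.measurableSet] with z hz
      rw [Real.norm_of_nonneg (by positivity)]
      gcongr
      exact (abs_sub _ _).trans (by gcongr; exact hgb z hz)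
    exact h1.congr_fun (fun x hx => by simp only [hgf x hx]) hΩ.measurableSet
  rw [ofReal_integral_eq_lintegral_ofReal hint
    (Filter.Eventually.of_forall fun z => by positivity)]
  calc ∫⁻ x in Ω, ENNReal.ofReal (|f x - m| ^ p)
      ≤ ∫⁻ x in Ω, (volume Ω)⁻¹ * ∫⁻ y in Ω, ‖g x - g y‖ₑ ^ p := by
        refine setLIntegral_mono' hΩ.measurableSet fun x hx => ?_
        rw [← ENNReal.ofReal_rpow_of_nonneg (abs_nonneg _) hp0, ← Real.enorm_eq_ofReal_abs,
          ← hgf x hx, hmean x]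
        have := enorm_average_rpow_le (μ := volume.restrict Ω) (h := fun y => g x - g y)
          (by fun_prop) hp
        rwa [Measure.restrict_apply_univ] at this
    _ = _ := lintegral_const_mul _ (Measurable.lintegral_prod_right'
        (f := fun q : E × E => ‖g q.1 - g q.2‖ₑ ^ p) (by fun_prop))

/-- One variable is confined to `S` because only segments issuing from `S` are known to stay in `D`.
-/
theorem oscInt_starshaped_le (hn : 1 ≤ n) {Ω : Set E} (hΩ : IsOpen Ω)
    (hb : Bornology.IsBounded Ω) (hne : Ω.Nonempty) {D S : Set E} (hD : IsOpen D) (hS : IsOpen S)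
    (hDΩ : D ⊆ Ω) (hDS : StarshapedWrt D S) {f : E → ℝ} (hf : ContDiffOn ℝ 1 f Ω) {p : ℝ}
    (hp : 1 ≤ p) : oscInt volume p (Ω.indicator f) D S ≤ ENNReal.ofReal
      (max (Metric.diam Ω) 1 ^ ((n : ℝ) + p - 1) / n * ((n + 1) *
        (unitBallVolume n ^ (1 - 1 / (n : ℝ)) * volume.real Ω ^ (1 / (n : ℝ)))))
      * ∫⁻ z, gradRpow Ω f p z := by
  set d : ℝ := max (Metric.diam Ω) 1 with hd
  have hdpos : 0 < d := lt_max_of_lt_right one_pos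
  have hdiam : ∀ y ∈ D, ∀ x ∈ S, ‖x - y‖ ≤ d := fun y hy x hx => by
    rw [← dist_eq_norm]
    exact (Metric.dist_le_diam_of_mem hb (hDΩ (hDS.2.1 hx)) (hDΩ hy)).trans (le_max_left _ _)
  have hA : ∀ z, ∫⁻ y in D, rieszKernel (z - y) ≤ ENNReal.ofReal ((n + 1) *
      (unitBallVolume n ^ (1 - 1 / (n : ℝ)) * volume.real Ω ^ (1 / (n : ℝ)))) := fun z =>
    (lintegral_mono_set hDΩ).trans (lintegral_rieszKernel_le hn
      (hΩ.measure_pos volume hne).ne' hb.measure_lt_top.ne z)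
  rw [ENNReal.ofReal_mul (by positivity)]
  refine le_trans ?_ (lintegral_lintegral_segment_le hn hp hdpos (measurable_gradRpow hΩ f p)
    hS.measurableSet hD.measurableSet hdiam hA)
  refine setLIntegral_mono' hD.measurableSet fun y hy =>
    setLIntegral_mono' hS.measurableSet fun x hx => ?_
  have hseg : segment ℝ y x ⊆ Ω := by
    rw [segment_symm]
    exact (hDS.2.2 x hx y hy).trans hDΩ
  rw [indicator_of_mem (hDΩ hy), indicator_of_mem (hDΩ (hDS.2.1 hx)), enorm_sub_rev]
  exact enorm_sub_rpow_le_lintegral_segment hΩ hf hp hseg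

/-- `Ω` lies in a closed ball of radius `diam Ω` about any of its points; the factor `n + 1` in
`kappa` is slack. -/
theorem volume_real_le_kappa {Ω : Set E} (hb : Bornology.IsBounded Ω) (hne : Ω.Nonempty) :
    volume.real Ω ≤ kappa Ω := by
  obtain ⟨x, hx⟩ := hne
  have hω := unitBallVolume_pos n
  have hsub : Ω ⊆ Metric.closedBall x (Metric.diam Ω) := fun y hy =>
    Metric.dist_le_diam_of_mem hb hy hx
  have h1 : volume.real Ω ≤ volume.real (Metric.closedBall x (Metric.diam Ω)) :=
    measureReal_mono hsub (Metric.isBounded_closedBall.measure_lt_top).ne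
  rw [measureReal_def volume (Metric.closedBall _ _), Measure.addHaar_closedBall _ _
    Metric.diam_nonneg, ENNReal.toReal_mul,
    ENNReal.toReal_ofReal (pow_nonneg Metric.diam_nonneg _), finrank_euclideanSpace_fin] at h1
  change _ ≤ Metric.diam Ω ^ n * unitBallVolume n at h1
  have h2 : 0 ≤ Metric.diam Ω ^ n * unitBallVolume n :=
    mul_nonneg (pow_nonneg Metric.diam_nonneg _) hω.le
  unfold kappa
  nlinarith [mul_nonneg (Nat.cast_nonneg (α := ℝ) n) h2]

variable {N : ℕ} {R : ℝ} {Ω : Set (EuclideanSpace ℝ (Fin n))}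
  {D : Fin N → Set (EuclideanSpace ℝ (Fin n))}

theorem IsStarshapedChain.subset (h : IsStarshapedChain Ω N R D) (i : Fin N) : D i ⊆ Ω :=
  h.iUnion_eq ▸ subset_iUnion D i

/-- The infimum is attained at a nonempty open overlap. The bound `2 ≤ N` makes the index type
nonempty; over an empty one the real infimum would be `0`. -/
theorem IsStarshapedChain.minOverlap_pos (h : IsStarshapedChain Ω N R D) (hN : 2 ≤ N) :
    0 < minOverlap D := by
  have : Nonempty {i : Fin N // 0 < i.val} := ⟨⟨⟨1, hN⟩, one_pos⟩⟩
  obtain ⟨i, hi⟩ := exists_eq_ciInf_of_finite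
    (f := fun i : {i : Fin N // 0 < i.val} => volume.real (D i.1 ∩ ⋃ j < i.1, D j))
  unfold minOverlap
  rw [← hi]
  have hopen : IsOpen (D i.1 ∩ ⋃ j < i.1, D j) :=
    (h.isOpen _).inter (isOpen_iUnion fun j => isOpen_iUnion fun _ => h.isOpen j)
  exact ENNReal.toReal_pos (hopen.measure_pos volume (h.chain i.1 i.2)).ne'
    ((h.isBounded i.1).subset inter_subset_left).measure_lt_top.ne

theorem minOverlap_le (D : Fin N → Set E) (i : Fin N) (hi : 0 < i.val) :
    minOverlap D ≤ volume.real (D i ∩ ⋃ j < i, D j) :=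
  ciInf_le (f := fun i : {i : Fin N // 0 < i.val} => volume.real (D i.1 ∩ ⋃ j < i.1, D j))
    (finite_range _).bddBelow ⟨i, hi⟩

theorem iUnion_lt_extend (D : Fin N → Set E) {k : ℕ} (hk : k ≤ N) :
    ⋃ j < k, (if hj : j < N then D ⟨j, hj⟩ else ∅) = ⋃ (j : Fin N) (_ : j.val < k), D j := by
  ext x
  simp only [mem_iUnion, exists_prop]
  constructor
  · rintro ⟨j, hj, hx⟩
    rw [dif_pos (hj.trans_le hk)] at hx
    exact ⟨⟨j, hj.trans_le hk⟩, hj, hx⟩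
  · rintro ⟨j, hj, hx⟩
    exact ⟨j, hj, by rwa [dif_pos j.2]⟩

theorem IsStarshapedChain.oscInt_le (hn : 1 ≤ n) (hΩ : IsOpen Ω) (hb : Bornology.IsBounded Ω)
    (hne : Ω.Nonempty) (hN : 2 ≤ N) (h : IsStarshapedChain Ω N R D) {f : E → ℝ}
    (hf : ContDiffOn ℝ 1 f Ω) {p : ℝ} (hp : 1 ≤ p) :
    oscInt volume p (Ω.indicator f) Ω Ω ≤ ENNReal.ofReal
      (minOverlap D / (unitBallVolume n * R ^ n) *
        (max (Metric.diam Ω) 1 ^ ((n : ℝ) + p - 1) / n * ((n + 1) *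
          (unitBallVolume n ^ (1 - 1 / (n : ℝ)) * volume.real Ω ^ (1 / (n : ℝ)))))
        * (1 + (2 : ℝ) ^ (p + 1) * (kappa Ω / minOverlap D)) ^ N)
      * ∫⁻ z, gradRpow Ω f p z := by
  have hω := unitBallVolume_pos n
  have hR := h.radius_pos
  have hlpos := h.minOverlap_pos hN
  have hfin : volume Ω ≠ ⊤ := hb.measure_lt_top.ne
  set l : ℝ := minOverlap D with hl
  set K : ℝ := max (Metric.diam Ω) 1 ^ ((n : ℝ) + p - 1) / n * ((n + 1) *
    (unitBallVolume n ^ (1 - 1 / (n : ℝ)) * volume.real Ω ^ (1 / (n : ℝ)))) with hK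
  have hK0 : 0 ≤ K := by
    have : 0 < max (Metric.diam Ω) 1 := lt_max_of_lt_right one_pos
    positivity
  set G : ℝ≥0∞ := ∫⁻ z, gradRpow Ω f p z with hG
  set g : E → ℝ := Ω.indicator f with hg
  have hgm : Measurable g := measurable_indicator_of_continuousOn hΩ hf.continuousOn
  have hvκ := volume_real_le_kappa hb hne
  have hκ : 0 ≤ kappa Ω := measureReal_nonneg.trans hvκ
  -- Chosen so that `2 ^ p * |Ω| ≤ q * l` and `1 + 2 * q` is the base of the power in `chainConst`.
  set q : ℝ := 2 ^ p * (kappa Ω / l) with hq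
  have hq0 : 0 ≤ q := by positivity
  set s : ℝ := unitBallVolume n * R ^ n with hs
  have hspos : 0 < s := by positivity
  have h2p : (2 : ℝ≥0∞) ^ p = ENNReal.ofReal (2 ^ p) := by
    rw [← ENNReal.ofReal_rpow_of_pos two_pos]
    simp
  have hΩq : 2 ^ p * volume Ω ≤ ENNReal.ofReal q * ENNReal.ofReal l := by
    rw [h2p, ← ENNReal.ofReal_toReal hfin, ← ENNReal.ofReal_mul (by positivity),
      ← ENNReal.ofReal_mul hq0, hq, mul_assoc, div_mul_cancel₀ _ hlpos.ne']
    refine ENNReal.ofReal_le_ofReal ?_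
    gcongr
    exact hvκ
  have hball : ∀ c : E, volume (Metric.ball c R) = ENNReal.ofReal s := fun c => by
    rw [Measure.addHaar_ball_of_pos _ _ hR, finrank_euclideanSpace_fin, hs, mul_comm,
      ENNReal.ofReal_mul hω.le, unitBallVolume, measureReal_def,
      ENNReal.ofReal_toReal measure_ball_lt_top.ne]
  -- The ball of measure `s` is the intermediate set for two points of `D i`. The factor `l / s` in
  -- `M` brings this bound to the form `q * M` required by `oscInt_chain_le`.
  have hself : ∀ i, oscInt volume p g (D i) (D i)
      ≤ ENNReal.ofReal q * (ENNReal.ofReal (l / s * K) * G) := by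
    intro i
    obtain ⟨c, hc⟩ := h.starshaped i
    have h1 := oscInt_starshaped_le hn hΩ hb hne (h.isOpen i) Metric.isOpen_ball (h.subset i) hc
      hf hp
    have hs0 : ENNReal.ofReal s ≠ 0 := by simpa using hspos
    refine (ENNReal.mul_le_mul_iff_right hs0 ENNReal.ofReal_ne_top).1 ?_
    calc ENNReal.ofReal s * oscInt volume p g (D i) (D i)
        = volume (Metric.ball c R) * oscInt volume p g (D i) (D i) := by rw [hball]
      _ ≤ 2 ^ (p - 1) * (volume (D i) * oscInt volume p g (D i) (Metric.ball c R)
            + volume (D i) * oscInt volume p g (Metric.ball c R) (D i)) :=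
          measure_mul_oscInt_le hgm hp _ _ _
      _ = (2 * 2 ^ (p - 1)) * volume (D i) * oscInt volume p g (D i) (Metric.ball c R) := by
          rw [oscInt_comm hgm p (Metric.ball c R)]
          ring
      _ = 2 ^ p * volume (D i) * oscInt volume p g (D i) (Metric.ball c R) := by
          congr 2
          conv_rhs => rw [show p = 1 + (p - 1) by ring]
          rw [ENNReal.rpow_add _ _ (by norm_num) (by norm_num), ENNReal.rpow_one]
      _ ≤ 2 ^ p * volume Ω * (ENNReal.ofReal K * G) := by
          gcongr
          exact h.subset i
      _ ≤ ENNReal.ofReal q * ENNReal.ofReal l * (ENNReal.ofReal K * G) := by gcongr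
      _ = ENNReal.ofReal s * (ENNReal.ofReal q * (ENNReal.ofReal (l / s * K) * G)) := by
          have : ENNReal.ofReal s * ENNReal.ofReal (l / s * K)
              = ENNReal.ofReal l * ENNReal.ofReal K := by
            rw [← ENNReal.ofReal_mul hspos.le, ← ENNReal.ofReal_mul hlpos.le]
            congr 1
            field_simp
          calc _ = ENNReal.ofReal q * (ENNReal.ofReal l * ENNReal.ofReal K) * G := by ring
            _ = _ := by rw [← this]; ring
  set D' : ℕ → Set E := fun j => if hj : j < N then D ⟨j, hj⟩ else ∅ with hD'
  have hD'eq : ∀ i (hi : i < N), D' i = D ⟨i, hi⟩ := fun i hi => dif_pos hi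
  have hunion : ⋃ j < N, D' j = Ω := by
    rw [iUnion_lt_extend D le_rfl, ← h.iUnion_eq]
    exact iUnion_congr fun j => by simp
  have hoverlap : ∀ i, 0 < i → i < N → ENNReal.ofReal l ≤ volume (D' i ∩ ⋃ j < i, D' j) := by
    intro i h0 hi
    rw [hD'eq i hi, iUnion_lt_extend D hi.le]
    exact ENNReal.ofReal_le_of_le_toReal (minOverlap_le D ⟨i, hi⟩ h0)
  have hchain := oscInt_chain_le (μ := volume) hgm hp (Ω := Ω) (N := N) (D := D')
    (fun i hi => by rw [hD'eq i hi]; exact h.subset _) (by simpa using hlpos)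
    ENNReal.ofReal_ne_top hΩq hoverlap (fun i hi => by rw [hD'eq i hi]; exact hself _)
    (by omega : 0 < N) le_rfl
  rw [hunion] at hchain
  refine (le_self_add.trans hchain).trans (le_of_eq ?_)
  have hpow : (1 + 2 * ENNReal.ofReal q) ^ N
      = ENNReal.ofReal ((1 + (2 : ℝ) ^ (p + 1) * (kappa Ω / l)) ^ N) := by
    rw [ENNReal.ofReal_pow (by positivity), ENNReal.ofReal_add one_pos.le (by positivity),
      ENNReal.ofReal_one, Real.rpow_add_one two_ne_zero, mul_comm (_ ^ p) (2 : ℝ), mul_assoc,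
      ← hq, ENNReal.ofReal_mul two_pos.le, ENNReal.ofReal_ofNat]
  rw [hpow, ENNReal.ofReal_mul (p := l / s * K) (by positivity)]
  ring

theorem IsStarshapedChain.poincareConst_pos (hn : 1 ≤ n) (hΩ : IsOpen Ω)
    (hb : Bornology.IsBounded Ω) (hne : Ω.Nonempty) (hN : 2 ≤ N) (h : IsStarshapedChain Ω N R D)
    (p : ℝ) : 0 < poincareConst Ω R D p := by
  have hω := unitBallVolume_pos n
  have hR := h.radius_pos
  have hl := h.minOverlap_pos hN
  have hv : 0 < volume.real Ω :=
    ENNReal.toReal_pos (hΩ.measure_pos volume hne).ne' hb.measure_lt_top.ne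
  have hκ : 0 < kappa Ω := hv.trans_le (volume_real_le_kappa hb hne)
  have hd : 0 < max (Metric.diam Ω) 1 := lt_max_of_lt_right one_pos
  unfold poincareConst chainConst
  positivity

theorem IsStarshapedChain.poincareWirtinger (hn : 1 ≤ n) (hΩ : IsOpen Ω)
    (hb : Bornology.IsBounded Ω) (hne : Ω.Nonempty) (hN : 2 ≤ N) (h : IsStarshapedChain Ω N R D)
    {f : E → ℝ} (hf : SmoothUpToBoundary Ω f) {p : ℝ} (hp : 1 ≤ p) :
    PoincareWirtinger Ω p (poincareConst Ω R D p) f := by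
  have hC := h.poincareConst_pos hn hΩ hb hne hN p
  have hv : 0 < volume.real Ω :=
    ENNReal.toReal_pos (hΩ.measure_pos volume hne).ne' hb.measure_lt_top.ne
  have hint0 : 0 ≤ ∫ z in Ω, ‖gradient f z‖ ^ p := integral_nonneg fun z => by positivity
  have h1 := integral_sub_average_rpow_le hΩ hb hne hf hp
  have h2 := h.oscInt_le hn hΩ hb hne hN (hf.1.of_le (by exact_mod_cast le_top)) hp
  rw [lintegral_gradRpow hΩ hb hf (by linarith)] at h2
  -- `ENNReal.ofReal` reflects the inequality because the right-hand side is nonnegative.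
  refine (ENNReal.ofReal_le_ofReal_iff (mul_nonneg hC.le hint0)).1 (h1.trans ?_)
  have hvol : (volume Ω)⁻¹ = ENNReal.ofReal (volume.real Ω)⁻¹ := by
    rw [ENNReal.ofReal_inv_of_pos hv, measureReal_def, ENNReal.ofReal_toReal hb.measure_lt_top.ne]
  rw [hvol, ENNReal.ofReal_mul hC.le]
  refine (mul_le_mul' le_rfl h2).trans (le_of_eq ?_)
  rw [← mul_assoc, ← ENNReal.ofReal_mul (by positivity)]
  congr 2
  have hn0 : (n : ℝ) ≠ 0 := by positivity
  have hs : unitBallVolume n * R ^ n ≠ 0 :=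
    (mul_pos (unitBallVolume_pos n) (pow_pos h.radius_pos n)).ne'
  unfold poincareConst chainConst
  simp only [div_eq_mul_inv, mul_inv]
  ring

end Chain

theorem corollary2 {n : ℕ} (hn : 1 ≤ n) (Ω : Set (EuclideanSpace ℝ (Fin n)))
    (hΩ : IsBoundedLipschitzDomain Ω) :
    (∀ p : ℝ, 1 ≤ p → ∃ C : ℝ, 0 < C ∧
      ∀ f : EuclideanSpace ℝ (Fin n) → ℝ, SmoothUpToBoundary Ω f → PoincareWirtinger Ω p C f) ∧
    (∃ (N : ℕ) (R : ℝ) (D : Fin N → Set (EuclideanSpace ℝ (Fin n))),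
      2 ≤ N ∧ IsStarshapedChain Ω N R D) ∧
    (∀ (N : ℕ) (R : ℝ) (D : Fin N → Set (EuclideanSpace ℝ (Fin n))),
      2 ≤ N → IsStarshapedChain Ω N R D →
      ∀ p : ℝ, 1 ≤ p → 0 < poincareConst Ω R D p ∧
        ∀ f : EuclideanSpace ℝ (Fin n) → ℝ, SmoothUpToBoundary Ω f →
          PoincareWirtinger Ω p (poincareConst Ω R D p) f) := by
  have hne := hΩ.isConnected.nonempty
  have hmain : ∀ (N : ℕ) (R : ℝ) (D : Fin N → Set (EuclideanSpace ℝ (Fin n))),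
      2 ≤ N → IsStarshapedChain Ω N R D →
      ∀ p : ℝ, 1 ≤ p → 0 < poincareConst Ω R D p ∧
        ∀ f : EuclideanSpace ℝ (Fin n) → ℝ, SmoothUpToBoundary Ω f →
          PoincareWirtinger Ω p (poincareConst Ω R D p) f := fun N R D hN h p hp =>
    ⟨h.poincareConst_pos hn hΩ.isOpen hΩ.isBounded hne hN p,
      fun f hf => h.poincareWirtinger hn hΩ.isOpen hΩ.isBounded hne hN hf hp⟩
  obtain ⟨N, R, D, hN, h⟩ := exists_isStarshapedChain hΩ
  exact ⟨fun p hp => ⟨_, hmain N R D hN h p hp⟩, ⟨N, R, D, hN, h⟩, hmain⟩
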